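/- Let $p$ be an odd prime, let $q$ be a power of $p$, and let $\mathbb F_q$ be a field with $q$ elements. All characters are complex multiplicative characters on $\mathbb F_q^*$, extended to $\mathbb F_q$ by the value $0$ at $0$; $\varepsilon$ is the trivial character, $\phi$ is the quadratic character, and $\overline{A}$ is the complex conjugate of $A$. For $y\in\mathbb F_q$ put \[ \zeta^y=\exp\Big(\frac{2\pi i}{p}\big(y^p+y^{p^2}+\dots+y^q\big)\Big), \] let $G(A)=\sum_{y\in\mathbb F_q}A(y)\zeta^y$ be the Gauss sum, and define for characters $A,B,C$ and $x\in\mathbb F_q$ \[ {}_2F_1\left(\begin{array}{c}A,B\\ C\end{array}\Big|\,x\right)=\frac{\varepsilon(x)}{q}\sum_{y\in\mathbb F_q}B(y)\,\overline{B}C(y-1)\,\overline{A}(1-xy). \] **Theorem.** Let $A$ and $B$ be characters such that $A$, $A^2\overline{B}$ and $\phi A\overline{B}$ are all nontrivial, and let $x\in\mathbb F_q$ with $x\neq-1$. Then \[ {}_2F_1\left(\begin{array}{c}A,B\\ A^2\end{array}\Big|\,\frac{4x}{(1+x)^2}\right)=\frac{\overline{A}(4)\,\phi B(-1)\,G(A^2\overline{B})\,G(\phi\overline{A}B)}{G(\phi)\,G(A)}\;B^2(1+x)\;{}_2F_1\left(\begin{array}{c}\phi\overline{A}B,\,B\\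 \phi A\end{array}\Big|\,x^2\right). \] -/

import Mathlib

/-- The additive character `y ↦ exp (2 π i Tr(y) / p)` of a finite field `F` of characteristic `p`,
where `Tr(y) = y ^ p + y ^ (p ^ 2) + ⋯ + y ^ q` is the trace from `F` to the prime field. -/
noncomputable def zetaChar (p : ℕ) [Fact p.Prime] (F : Type*) [Field F] [Fintype F]
    [Algebra (ZMod p) F] : AddChar F ℂ :=
  (ZMod.stdAddChar (N := p)).compAddMonoidHom (Algebra.trace (ZMod p) F).toAddMonoidHom

/-- The Gauss sum `G(A) = ∑ y, A(y) ζ ^ y` of a complex multiplicative character. -/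
noncomputable def G (p : ℕ) [Fact p.Prime] {F : Type*} [Field F] [Fintype F]
    [Algebra (ZMod p) F] (A : MulChar F ℂ) : ℂ :=
  gaussSum A (zetaChar p F)

/-- The quadratic character `φ` of a finite field, with complex values. -/
noncomputable def phi (F : Type*) [Field F] [Fintype F] [DecidableEq F] : MulChar F ℂ :=
  (quadraticChar F).ringHomComp (Int.castRingHom ℂ)

/-- The hypergeometric function `₂F₁(A, B; C | x)` over a finite field. All characters, including
the trivial character `1`, take the value `0` at `0`; for complex characters on a finite field
`A⁻¹` is the complex conjugate of `A`. -/
noncomputable def hypF {F : Type*} [Field F] [Fintype F] (A B C : MulChar F ℂ) (x : F) : ℂ :=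
  (1 : MulChar F ℂ) x / (Fintype.card F : ℂ) *
    ∑ y : F, B y * (B⁻¹ * C) (y - 1) * A⁻¹ (1 - x * y)

section CharacterSums

open Finset

variable {F : Type*} [Field F]

/-! Put `D = A ^ 2 * B⁻¹` and `E = phi F * A⁻¹ * D = phi F * A * B⁻¹`. Both sides reduce to `S = ∑
c, A⁻¹ (1 - c ^ 2) * D (1 + x ^ 2 - 2 * x * c)`. A change of variable turns the left side into `S`
(`sum_eq_sum_inv_one_sub_sq`). Writing both factors of `S` as Gauss-sum integrals makes the exponent
quadratic in `c`. Completing the square sums out `c`, at the cost of a quadratic Gauss sum, and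
leaves the exponent `s * ((1 + k) * (1 + x ^ 2 * k))`; the sum over `s` is then a Gauss sum of `E⁻¹`
(`sum_inv_one_sub_sq_mul`). The remaining sum over `k` is the right side after an inversion
(`sum_inv_mul_eq_sum`). -/

lemma MulChar.neg_one_mul_self (χ : MulChar F ℂ) : χ (-1) * χ (-1) = 1 := by
  rw [← map_mul]; simp

lemma MulChar.apply_inv (χ : MulChar F ℂ) (a : F) : χ a⁻¹ = (χ a)⁻¹ := by
  rw [← MulChar.inv_apply', MulChar.inv_apply_eq_inv']

lemma MulChar.apply_ne_zero (χ : MulChar F ℂ) {a : F} (ha : a ≠ 0) : χ a ≠ 0 :=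
  MulChar.apply_ne_zero_iff.2 ha.isUnit

variable [Fintype F]

/-- Nontriviality of `χ` is what makes this hold at `u = 0` too, so later expansions need no
exceptional terms. -/
lemma sum_mulChar_mul_addChar_mul {χ : MulChar F ℂ} (hχ : χ ≠ 1) (ψ : AddChar F ℂ) (u : F) :
    ∑ a, χ a * ψ (a * u) = χ⁻¹ u * gaussSum χ ψ := by
  rcases eq_or_ne u 0 with rfl | hu
  · simp [MulChar.map_zero, MulChar.sum_eq_zero_of_ne_one hχ]
  · have := gaussSum_mulShift_eq χ ψ (Units.mk0 u hu)
    simpa [gaussSum, AddChar.mulShift_apply, mul_comm u] using this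

lemma gaussSum_mul_gaussSum_inv {χ : MulChar F ℂ} (hχ : χ ≠ 1) {ψ : AddChar F ℂ}
    (hψ : ψ.IsPrimitive) :
    gaussSum χ ψ * gaussSum χ⁻¹ ψ = χ (-1) * Fintype.card F := by
  rw [← gaussSum_mul_gaussSum_eq_card hχ hψ, ← mul_gaussSum_inv_eq_gaussSum χ⁻¹ ψ,
    MulChar.inv_apply', inv_neg_one]
  ring

lemma gaussSum_complex_ne_zero {χ : MulChar F ℂ} (hχ : χ ≠ 1) {ψ : AddChar F ℂ}
    (hψ : ψ.IsPrimitive) : gaussSum χ ψ ≠ 0 :=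
  gaussSum_ne_zero_of_nontrivial (Nat.cast_ne_zero.2 Fintype.card_ne_zero) hχ hψ

lemma sum_eq_sum_inv_one_sub_sq (hF : ringChar F ≠ 2) (A B : MulChar F ℂ) {x : F} (hx0 : x ≠ 0)
    (hx : 1 + x ≠ 0) :
    ∑ y, B y * (B⁻¹ * A ^ 2) (y - 1) * A⁻¹ (1 - 4 * x / (1 + x) ^ 2 * y) =
      A (-1) * A⁻¹ 4 * A⁻¹ (x ^ 2) * (B ^ 2) (1 + x) *
        ∑ c, A⁻¹ (1 - c ^ 2) * (A ^ 2 * B⁻¹) (1 + x ^ 2 - 2 * x * c) := by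
  have h2 : (2 : F) ≠ 0 := Ring.two_ne_zero hF
  have h4 : (4 : F) = 2 * 2 := by norm_num
  have ht : 2 * x * ((1 + x) * (1 + x))⁻¹ ≠ 0 := by simp [h2, hx0, hx]
  -- Substitute `y = (1 + x) ^ 2 / (2 * x * (1 + c))`. Since `0⁻¹ = 0`, this is a bijection of `F`
  -- sending `c = -1` to `y = 0`, where both summands vanish.
  rw [← Equiv.sum_comp (((Equiv.addLeft 1).trans (Equiv.mulLeft₀ _ ht)).trans (Equiv.inv F)),
    mul_sum]
  refine sum_congr rfl fun c _ => ?_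
  simp only [Equiv.trans_apply, Equiv.coe_addLeft, Equiv.mulLeft₀_apply, Equiv.inv_apply]
  rcases eq_or_ne (1 + c) 0 with hc | hc
  · have : 1 - c ^ 2 = 0 := by linear_combination (1 - c) * hc
    simp [hc, this, MulChar.map_zero]
  have e1 : (2 * x * ((1 + x) * (1 + x))⁻¹ * (1 + c))⁻¹ - 1 =
      (1 + x ^ 2 - 2 * x * c) * (2 * x * (1 + c))⁻¹ := by
    field_simp
    ring
  have e2 : 1 - 4 * x / (1 + x) ^ 2 * (2 * x * ((1 + x) * (1 + x))⁻¹ * (1 + c))⁻¹ =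
      (c - 1) * (1 + c)⁻¹ := by
    field_simp
    ring
  have e3 : 1 - c ^ 2 = -1 * ((c - 1) * (1 + c)) := by ring
  rw [e1, e2, e3, h4]
  simp only [MulChar.mul_apply, MulChar.inv_apply_eq_inv', MulChar.pow_apply' _ two_ne_zero,
    map_mul, map_pow, MulChar.apply_inv, mul_inv, inv_inv]
  have hA1 := MulChar.apply_ne_zero A (neg_ne_zero.2 (one_ne_zero (α := F)))
  have hA2 := MulChar.apply_ne_zero A h2
  have hAx := MulChar.apply_ne_zero A hx0
  have hAc := MulChar.apply_ne_zero A hc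
  have hB2 := MulChar.apply_ne_zero B h2
  have hBx := MulChar.apply_ne_zero B hx0
  have hBc := MulChar.apply_ne_zero B hc
  -- These values may be `0`; they are kept as atoms so that `field_simp` does not have to clear
  -- them.
  generalize (A (c - 1))⁻¹ = u
  generalize (B (1 + x ^ 2 - 2 * x * c))⁻¹ = v
  field_simp

section Quadratic

variable [DecidableEq F]

lemma phi_isQuadratic : (phi F).IsQuadratic :=
  (quadraticChar_isQuadratic F).comp _

lemma phi_inv : (phi F)⁻¹ = phi F := phi_isQuadratic.inv

lemma phi_sq_eq_one {a : F} (ha : a ≠ 0) : phi F a ^ 2 = 1 := by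
  rw [← MulChar.pow_apply' _ two_ne_zero, phi_isQuadratic.sq_eq_one, MulChar.one_apply ha.isUnit]

lemma phi_ne_one (hF : ringChar F ≠ 2) : phi F ≠ 1 :=
  (MulChar.ringHomComp_ne_one_iff (RingHom.injective_int _)).2 (quadraticChar_ne_one hF)

/-- Each `m` has `phi F m + 1` square roots. -/
lemma sum_comp_sq (hF : ringChar F ≠ 2) (f : F → ℂ) :
    ∑ c, f (c ^ 2) = ∑ m, (phi F m + 1) * f m := by
  rw [← sum_fiberwise_of_maps_to (g := fun c : F => c ^ 2) (t := univ) fun _ _ => mem_univ _]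
  refine sum_congr rfl fun m _ => ?_
  rw [sum_congr rfl (g := fun _ => f m) fun c hc => by rw [(mem_filter.1 hc).2], sum_const,
    nsmul_eq_mul]
  congr 1
  have h := congrArg (Int.cast : ℤ → ℂ) (quadraticChar_card_sqrts hF m)
  have h2 : #{c : F | c ^ 2 = m} = #{c : F | c ^ 2 = m}.toFinset := by
    congr 1; ext; simp
  rw [h2]
  simpa [phi] using h

lemma sum_addChar_mul_sq (hF : ringChar F ≠ 2) {ψ : AddChar F ℂ} (hψ : ψ.IsPrimitive) {s : F}
    (hs : s ≠ 0) : ∑ c, ψ (s * c ^ 2) = phi F s * gaussSum (phi F) ψ := by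
  rw [sum_comp_sq hF fun m => ψ (s * m)]
  simp_rw [add_mul, one_mul, sum_add_distrib, mul_comm s]
  rw [AddChar.sum_mulShift s hψ, if_neg hs, sum_mulChar_mul_addChar_mul (phi_ne_one hF), phi_inv]
  simp

/-- The exponent equals `-s * (c + x * k) ^ 2 + s * ((1 + k) * (1 + x ^ 2 * k))`. -/
lemma sum_addChar_quadratic (hF : ringChar F ≠ 2) {ψ : AddChar F ℂ} (hψ : ψ.IsPrimitive) {s : F}
    (hs : s ≠ 0) (k x : F) :
    ∑ c, ψ (s * (1 - c ^ 2) + s * k * (1 + x ^ 2 - 2 * x * c)) =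
      phi F (-1) * phi F s * gaussSum (phi F) ψ * ψ (s * ((1 + k) * (1 + x ^ 2 * k))) := by
  rw [← map_mul, neg_one_mul, ← sum_addChar_mul_sq hF hψ (neg_ne_zero.2 hs), sum_mul,
    ← Equiv.sum_comp (Equiv.subRight (x * k))]
  refine sum_congr rfl fun c _ => ?_
  rw [← AddChar.map_add_eq_mul]
  congr 1
  simp only [Equiv.subRight_apply]
  ring

lemma sum_inv_one_sub_sq_mul (hF : ringChar F ≠ 2) {ψ : AddChar F ℂ} (hψ : ψ.IsPrimitive)
    {A D : MulChar F ℂ} (hA : A ≠ 1) (hD : D ≠ 1) (hE : phi F * A⁻¹ * D ≠ 1) (x : F) :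
    gaussSum A ψ * gaussSum D⁻¹ ψ * ∑ c, A⁻¹ (1 - c ^ 2) * D (1 + x ^ 2 - 2 * x * c) =
      phi F (-1) * gaussSum (phi F) ψ * gaussSum (phi F * A⁻¹ * D)⁻¹ ψ *
        ∑ k, D⁻¹ k * (phi F * A⁻¹ * D) ((1 + k) * (1 + x ^ 2 * k)) := by
  have hE' : (phi F * A⁻¹ * D)⁻¹ = phi F * A * D⁻¹ := by
    simp only [mul_inv, inv_inv, phi_inv]
  have hexpand (c : F) :
      gaussSum A ψ * gaussSum D⁻¹ ψ * (A⁻¹ (1 - c ^ 2) * D (1 + x ^ 2 - 2 * x * c)) =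
        ∑ s, ∑ k, A s * D⁻¹ s * D⁻¹ k *
          ψ (s * (1 - c ^ 2) + s * k * (1 + x ^ 2 - 2 * x * c)) := by
    have h1 := sum_mulChar_mul_addChar_mul hA ψ (1 - c ^ 2)
    have h2 := sum_mulChar_mul_addChar_mul (inv_ne_one.2 hD) ψ (1 + x ^ 2 - 2 * x * c)
    rw [inv_inv] at h2
    calc _ = (A⁻¹ (1 - c ^ 2) * gaussSum A ψ) *
          (D (1 + x ^ 2 - 2 * x * c) * gaussSum D⁻¹ ψ) := by ring
      _ = _ := by
        rw [← h1, ← h2, sum_mul]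
        refine sum_congr rfl fun s _ => ?_
        rcases eq_or_ne s 0 with rfl | hs
        · simp [MulChar.map_zero]
        -- The second Gauss-sum variable is rescaled to `s * k`, so that `s` factors out of the
        -- whole exponent.
        rw [mul_sum, ← Equiv.sum_comp (Equiv.mulLeft₀ s hs)]
        refine sum_congr rfl fun k _ => ?_
        rw [AddChar.map_add_eq_mul, Equiv.mulLeft₀_apply, map_mul D⁻¹, mul_assoc s k]
        ring
  calc _ = ∑ s, ∑ k, A s * D⁻¹ s * D⁻¹ k *
          ∑ c, ψ (s * (1 - c ^ 2) + s * k * (1 + x ^ 2 - 2 * x * c)) := by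
        rw [mul_sum, sum_congr rfl fun c _ => hexpand c, sum_comm]
        refine sum_congr rfl fun s _ => ?_
        rw [sum_comm]
        exact sum_congr rfl fun k _ => (mul_sum ..).symm
    _ = ∑ s, ∑ k, phi F (-1) * gaussSum (phi F) ψ * D⁻¹ k *
          ((phi F * A * D⁻¹) s * ψ (s * ((1 + k) * (1 + x ^ 2 * k)))) := by
        refine sum_congr rfl fun s _ => sum_congr rfl fun k _ => ?_
        rcases eq_or_ne s 0 with rfl | hs
        · simp [MulChar.map_zero]
        rw [sum_addChar_quadratic hF hψ hs]
        simp only [MulChar.mul_apply]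
        ring
    _ = _ := by
        rw [sum_comm, mul_sum]
        refine sum_congr rfl fun k _ => ?_
        rw [← mul_sum, ← hE', sum_mulChar_mul_addChar_mul (inv_ne_one.2 hE), inv_inv]
        ring

lemma sum_inv_mul_eq_sum (A B : MulChar F ℂ) {x : F} (hx0 : x ≠ 0) :
    ∑ k, (A ^ 2 * B⁻¹)⁻¹ k * (phi F * A * B⁻¹) ((1 + k) * (1 + x ^ 2 * k)) =
      A (-1) * phi F (-1) * A (x ^ 2) *
        ∑ y, B y * (B⁻¹ * (phi F * A)) (y - 1) * (phi F * A * B⁻¹) (1 - x ^ 2 * y) := by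
  -- Substitute `k = -1 / (x ^ 2 * y)`; `y = 0` corresponds to `k = 0`, where both summands vanish.
  rw [← Equiv.sum_comp
    (((Equiv.mulLeft₀ _ (pow_ne_zero 2 hx0)).trans (Equiv.inv F)).trans (Equiv.neg F)), mul_sum]
  refine sum_congr rfl fun y _ => ?_
  simp only [Equiv.trans_apply, Equiv.mulLeft₀_apply, Equiv.inv_apply, Equiv.neg_apply]
  rcases eq_or_ne y 0 with rfl | hy
  · simp [MulChar.map_zero]
  have e1 : 1 + -(x ^ 2 * y)⁻¹ = -1 * ((1 - x ^ 2 * y) * (x ^ 2 * y)⁻¹) := by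
    field_simp
    ring
  have e2 : 1 + x ^ 2 * -(x ^ 2 * y)⁻¹ = (y - 1) * y⁻¹ := by
    field_simp
    ring
  rw [e1, e2, ← neg_one_mul (x ^ 2 * y)⁻¹]
  simp only [MulChar.mul_apply, MulChar.inv_apply_eq_inv', MulChar.pow_apply' _ two_ne_zero,
    map_mul, map_pow, MulChar.apply_inv, mul_inv, inv_inv]
  have hAs := MulChar.neg_one_mul_self A
  have hpx := phi_sq_eq_one hx0
  have hpy := phi_sq_eq_one hy
  have hA1 := MulChar.apply_ne_zero A (neg_ne_zero.2 (one_ne_zero (α := F)))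
  have hB1 := MulChar.apply_ne_zero B (neg_ne_zero.2 (one_ne_zero (α := F)))
  have hAx := MulChar.apply_ne_zero A hx0
  have hAy := MulChar.apply_ne_zero A hy
  have hBx := MulChar.apply_ne_zero B hx0
  have hBy := MulChar.apply_ne_zero B hy
  have hPx := MulChar.apply_ne_zero (phi F) hx0
  have hPy := MulChar.apply_ne_zero (phi F) hy
  generalize (B (y - 1))⁻¹ = u
  generalize (B (1 - x ^ 2 * y))⁻¹ = v
  field_simp
  rw [hpx, hpy, pow_two (A (-1)), hAs]
  ring

end Quadratic

end CharacterSums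

lemma zetaChar_isPrimitive (p : ℕ) [Fact p.Prime] (F : Type*) [Field F] [Fintype F]
    [Algebra (ZMod p) F] : (zetaChar p F).IsPrimitive := by
  refine AddChar.IsPrimitive.of_ne_one (AddChar.ne_one_iff.2 ?_)
  obtain ⟨a, ha⟩ := Algebra.trace_surjective (ZMod p) F 1
  refine ⟨a, fun h => one_ne_zero (α := ZMod p) ?_⟩
  rw [← ha]
  exact ((ZMod.isPrimitive_stdAddChar p).zmod_char_eq_one_iff p _).1 h

lemma phi_mul_inv_mul_inv {F : Type*} [Field F] [Fintype F] [DecidableEq F] (A B : MulChar F ℂ) :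
    (phi F * A⁻¹ * B)⁻¹ = phi F * A * B⁻¹ := by
  simp only [mul_inv, inv_inv, phi_inv]

theorem theorem2 (p : ℕ) [Fact p.Prime] (hp : p ≠ 2)
    (F : Type*) [Field F] [Fintype F] [DecidableEq F] [Algebra (ZMod p) F]
    (A B : MulChar F ℂ) (hA : A ≠ 1) (hAB : A ^ 2 * B⁻¹ ≠ 1) (hphiAB : phi F * A * B⁻¹ ≠ 1)
    (x : F) (hx : x ≠ -1) :
    hypF A B (A ^ 2) (4 * x / (1 + x) ^ 2) =
      A⁻¹ 4 * (phi F * B) (-1) * G p (A ^ 2 * B⁻¹) * G p (phi F * A⁻¹ * B) /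
          (G p (phi F) * G p A) *
        (B ^ 2) (1 + x) * hypF (phi F * A⁻¹ * B) B (phi F * A) (x ^ 2) := by
  have hF : ringChar F ≠ 2 := by
    have : CharP F p := charP_of_injective_algebraMap (algebraMap (ZMod p) F).injective p
    rwa [ringChar.eq F p]
  rcases eq_or_ne x 0 with rfl | hx0
  -- Both sides are `0` because the trivial character vanishes at `0`.
  · simp [hypF, MulChar.map_zero]
  have hx1 : 1 + x ≠ 0 := fun h => hx (by linear_combination h)
  have h4 : (4 : F) ≠ 0 := by
    have h := pow_ne_zero 2 (Ring.two_ne_zero hF)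
    norm_num at h
    exact h
  have hz : 4 * x / (1 + x) ^ 2 ≠ 0 := div_ne_zero (mul_ne_zero h4 hx0) (pow_ne_zero 2 hx1)
  have hψ := zetaChar_isPrimitive p F
  have hchar : phi F * A⁻¹ * (A ^ 2 * B⁻¹) = phi F * A * B⁻¹ := by group
  have hkey := sum_inv_one_sub_sq_mul hF hψ hA hAB (by rwa [hchar]) x
  rw [hchar, sum_inv_mul_eq_sum A B hx0, ← phi_mul_inv_mul_inv, inv_inv] at hkey
  rw [hypF, hypF, sum_eq_sum_inv_one_sub_sq hF A B hx0 hx1, MulChar.one_apply hz.isUnit,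
    MulChar.one_apply (pow_ne_zero 2 hx0).isUnit]
  simp only [G]
  have hφ := gaussSum_mul_gaussSum_inv (phi_ne_one hF) hψ
  rw [phi_inv] at hφ
  have hD := gaussSum_mul_gaussSum_inv hAB hψ
  have hD1 : (A ^ 2 * B⁻¹) (-1) = B (-1) := by
    rw [MulChar.mul_apply, MulChar.pow_apply' _ two_ne_zero, pow_two, MulChar.neg_one_mul_self,
      MulChar.inv_apply', inv_neg_one, one_mul]
  rw [hD1] at hD
  have hφ0 := gaussSum_complex_ne_zero (phi_ne_one hF) hψ
  have hA0 := gaussSum_complex_ne_zero hA hψ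
  have hD0 := gaussSum_complex_ne_zero (inv_ne_one.2 hAB) hψ
  have hφs := MulChar.neg_one_mul_self (phi F)
  have hAs := MulChar.neg_one_mul_self A
  have hBs := MulChar.neg_one_mul_self B
  have hAx := MulChar.apply_ne_zero A (pow_ne_zero 2 hx0)
  rw [MulChar.inv_apply_eq_inv' A (x ^ 2), MulChar.mul_apply (phi F) B]
  generalize gaussSum (phi F) (zetaChar p F) = gφ at *
  generalize gaussSum (phi F * A⁻¹ * B) (zetaChar p F) = gE at *
  generalize gaussSum (A ^ 2 * B⁻¹)⁻¹ (zetaChar p F) = gD' at *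
  generalize gaussSum (A ^ 2 * B⁻¹) (zetaChar p F) = gD at *
  generalize gaussSum A (zetaChar p F) = gA at *
  generalize ∑ c, A⁻¹ (1 - c ^ 2) * (A ^ 2 * B⁻¹) (1 + x ^ 2 - 2 * x * c) = S at *
  generalize ∑ y, B y * (B⁻¹ * (phi F * A)) (y - 1) *
    (phi F * A⁻¹ * B)⁻¹ (1 - x ^ 2 * y) = T at *
  -- `hkey` has `gφ` in the numerator and `gD'` beside `S`. The relations `gφ ^ 2 = φ(-1) q` and `gD
  -- * gD' = B(-1) q` move `gφ` to the denominator and trade `gD'` for `gD`, and `q` cancels.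
  have hS : A (-1) * (A (x ^ 2))⁻¹ * S =
      phi F (-1) * B (-1) * gD * gE / (gφ * gA) * T := by
    rw [inv_eq_one_div]
    field_simp
    refine mul_right_cancel₀ hD0 ?_
    linear_combination A (-1) * gφ * hkey + phi F (-1) ^ 2 * gφ ^ 2 * gE * A (x ^ 2) * T * hAs +
      gφ ^ 2 * gE * A (x ^ 2) * T * hφs + gE * A (x ^ 2) * T * hφ -
      phi F (-1) * B (-1) * gE * T * A (x ^ 2) * hD -
      phi F (-1) * (Fintype.card F : ℂ) * gE * T * A (x ^ 2) * hBs
  linear_combination A⁻¹ 4 * (B ^ 2) (1 + x) * (1 / (Fintype.card F : ℂ)) * hS
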